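/- Let $X$ be a complex Banach space with open unit ball $B_X$. Let $\mathcal H^\infty(B_X)$ be the Banach algebra of bounded holomorphic functions $B_X\to\mathbb C$ and $\mathcal A_u(B_X)$ the Banach algebra of uniformly continuous holomorphic functions $B_X\to\mathbb C$, both with the supremum norm, and let $\mathcal A$ be one of these two algebras. Let $\mathcal M(\mathcal A)$ be the set of nonzero (automatically continuous) homomorphisms $\mathcal A\to\mathbb C$, with the Gleason metric $\|\varphi-\psi\|$ (the norm of $\mathcal A^*$). For $z\in\overline B_{X^{**}}$ let $\mathcal M_z=\{\varphi\in\mathcal M(\mathcal A):\varphi|_{X^*}=z\}$, where $X^*\subset\mathcal A$ by restriction to $B_X$; regard $X\subset X^{**}$. Let $\Phi\colon B_X\to B_X$ be an automorphism (a holomorphic bijection with holomorphic inverse); if $\mathcal A=\mathcal A_u(B_X)$, assume also that $\Phi$ and $\Phi^{-1}$ are uniformly continuous. (i) For $f\in\mathcal A$ the functions $f\circ\Phi$ and $f\circ\Phi^{-1}$ belong to $\mathcal A$, so that there is a composition operator $C_\Phi\colon\mathcal A\to\mathcal A$, $C_\Phi(f)=f\circ\Phi$. The restriction of its transpose, $\Lambda_\Phi\colon\mathcal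 M(\mathcal A)\to\mathcal M(\mathcal A)$, $\Lambda_\Phi(\varphi)=\varphi\circ C_\Phi$, is a surjective isometry for the Gleason metric, with inverse $\Lambda_\Phi^{-1}=\Lambda_{\Phi^{-1}}$. (ii) Suppose that for every $x^*\in X^*$ the functions $x^*\circ\Phi$ and $x^*\circ\Phi^{-1}$ are uniform limits on $B_X$ of finite type polynomials (elements of the unital algebra of functions generated by $X^*$). Then $\Phi$ has a unique extension to a map from $\overline B_X$ to $\overline B_{X^{**}}$ that is continuous from the norm topology to the weak-star topology; denoting it again by $\Phi$, we have $\Lambda_\Phi(\mathcal M_x)=\mathcal M_{\Phi(x)}$ for every $x\in\overline B_X$. If $\Phi$ is uniformly continuous (in particular if $\mathcal A=\mathcal A_u(B_X)$), the same holds with $\Phi\colon\overline B_X\to\overline B_X$ the unique norm continuous extension. (iii) Suppose in addition to the hypothesis of (ii) that $X$ is symmetrically regular, that is, every continuous linear map $T\colon X\to X^*$ with $T(x)(y)=T(y)(x)$ for all $x,y\in X$ is weakly compact. For a bounded holomorphic function $f=\sum_n P_n$ on $B_X$ (Taylor series at $0$) let $\tilde f=\sum_n\tilde P_n$ be its canonical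 extension to $B_{X^{**}}$, where $\tilde P_n$ is the Aron--Berner extension of the $n$-homogeneous polynomial $P_n$. Then there is a unique weak-star continuous map $\tilde\Phi\colon\overline B_{X^{**}}\to\overline B_{X^{**}}$ such that $\tilde\Phi(z)(x^*)=\widetilde{x^*\circ\Phi}(z)$ for all $z\in B_{X^{**}}$ and $x^*\in X^*$, and $\Lambda_\Phi(\mathcal M_z)=\mathcal M_{\tilde\Phi(z)}$ for every $z\in\overline B_{X^{**}}$. -/

import Mathlib

open Metric


noncomputable section

namespace BallAlgebra

variable {X : Type*} [NormedAddCommGroup X] [NormedSpace ℂ X]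

/-- The open unit ball of `X`, as a type. -/
abbrev Ball (X : Type*) [NormedAddCommGroup X] : Type _ := ball (0 : X) 1

/-- The closed unit ball of `X`, with the norm topology. -/
abbrev ClosedBall (X : Type*) [NormedAddCommGroup X] : Type _ := closedBall (0 : X) 1

/-- The bidual of `X`, as a Banach space. -/
abbrev Bidual (X : Type*) [NormedAddCommGroup X] [NormedSpace ℂ X] : Type _ :=
  StrongDual ℂ (StrongDual ℂ X)

/-- The closed unit ball of the bidual of `X`, with the weak-star topology. -/
abbrev BidualBall (X : Type*) [NormedAddCommGroup X] [NormedSpace ℂ X] : Type _ :=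
  {z : WeakDual ℂ (StrongDual ℂ X) // ‖WeakDual.toStrongDual z‖ ≤ 1}

/-- A point of the closed unit ball of the bidual, as an element of the Banach space `X**`. -/
def bidualPt (z : BidualBall X) : Bidual X := WeakDual.toStrongDual z.1

/-- The canonical embedding `X → X**`. -/
def toBidual (x : X) : Bidual X := NormedSpace.inclusionInDoubleDual ℂ X x

/-- The extension by zero of a function on the open unit ball. -/
def zeroExt {E : Type*} [Zero E] (f : Ball X → E) (x : X) : E :=
  open Classical in if h : x ∈ ball (0 : X) 1 then f ⟨x, h⟩ else 0

/-- `f` is holomorphic (complex-analytic) on the open unit ball. -/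
def Holomorphic {E : Type*} [NormedAddCommGroup E] [NormedSpace ℂ E] (f : Ball X → E) : Prop :=
  AnalyticOnNhd ℂ (zeroExt f) (ball (0 : X) 1)

lemma holomorphic_of {E : Type*} [NormedAddCommGroup E] [NormedSpace ℂ E] {f : Ball X → E}
    (F : X → E) (hF : AnalyticOnNhd ℂ F (ball (0 : X) 1)) (h : ∀ x : Ball X, F x = f x) :
    Holomorphic f := by
  refine hF.congr isOpen_ball ?_
  intro x hx
  simp only [zeroExt, dif_pos hx]
  exact h ⟨x, hx⟩

lemma zeroExt_coe {E : Type*} [Zero E] (f : Ball X → E) (x : Ball X) :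
    zeroExt f (x : X) = f x := by
  simp only [zeroExt, dif_pos x.2]

/-- The Banach algebra of bounded holomorphic functions on the open unit ball, with the
supremum norm. -/
def Hinf (X : Type*) [NormedAddCommGroup X] [NormedSpace ℂ X] :
    Subalgebra ℂ (BoundedContinuousFunction (Ball X) ℂ) where
  carrier := {f | Holomorphic f}
  mul_mem' {f g} hf hg :=
    holomorphic_of (fun x => zeroExt f x * zeroExt g x) (AnalyticOnNhd.mul hf hg)
      fun x => by simp [zeroExt_coe]
  add_mem' {f g} hf hg :=
    holomorphic_of (fun x => zeroExt f x + zeroExt g x) (AnalyticOnNhd.add hf hg)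
      fun x => by simp [zeroExt_coe]
  algebraMap_mem' c := holomorphic_of (fun _ => c) analyticOnNhd_const fun _ => rfl

lemma uniformContinuous_mul (f g : BoundedContinuousFunction (Ball X) ℂ)
    (hf : UniformContinuous f) (hg : UniformContinuous g) :
    UniformContinuous (f * g : BoundedContinuousFunction (Ball X) ℂ) := by
  rw [Metric.uniformContinuous_iff] at *
  intro ε hε
  have hC : 0 < ‖f‖ + ‖g‖ + 1 := by positivity
  have hδ : 0 < ε / (‖f‖ + ‖g‖ + 1) := by positivity
  obtain ⟨a, ha, hfa⟩ := hf _ hδ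
  obtain ⟨b, hb, hgb⟩ := hg _ hδ
  refine ⟨min a b, lt_min ha hb, fun {x y} hxy => ?_⟩
  have h1 := hfa (lt_of_lt_of_le hxy (min_le_left _ _))
  have h2 := hgb (lt_of_lt_of_le hxy (min_le_right _ _))
  rw [dist_eq_norm] at h1 h2 ⊢
  have e : (f * g : BoundedContinuousFunction (Ball X) ℂ) x
      - (f * g : BoundedContinuousFunction (Ball X) ℂ) y
      = f x * (g x - g y) + (f x - f y) * g y := by
    simp only [BoundedContinuousFunction.coe_mul, Pi.mul_apply]; ring
  rw [e]
  have hfx := f.norm_coe_le_norm x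
  have hgy := g.norm_coe_le_norm y
  calc ‖f x * (g x - g y) + (f x - f y) * g y‖
      ≤ ‖f x‖ * ‖g x - g y‖ + ‖f x - f y‖ * ‖g y‖ := by
        refine (norm_add_le _ _).trans ?_
        rw [norm_mul, norm_mul]
    _ ≤ ‖f‖ * (ε / (‖f‖ + ‖g‖ + 1)) + (ε / (‖f‖ + ‖g‖ + 1)) * ‖g‖ := by gcongr
    _ < (‖f‖ + ‖g‖ + 1) * (ε / (‖f‖ + ‖g‖ + 1)) := by nlinarith
    _ = ε := by field_simp

/-- The Banach algebra of uniformly continuous holomorphic functions on the open unit ball, with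
the supremum norm. (Uniformly continuous functions on the ball are bounded.) -/
def Au (X : Type*) [NormedAddCommGroup X] [NormedSpace ℂ X] :
    Subalgebra ℂ (BoundedContinuousFunction (Ball X) ℂ) where
  carrier := {f | Holomorphic f ∧ UniformContinuous f}
  mul_mem' {f g} hf hg := ⟨(Hinf X).mul_mem hf.1 hg.1, uniformContinuous_mul f g hf.2 hg.2⟩
  add_mem' hf hg := ⟨(Hinf X).add_mem hf.1 hg.1, hf.2.add hg.2⟩
  algebraMap_mem' c := ⟨(Hinf X).algebraMap_mem c, uniformContinuous_const⟩

/-- The two algebras under consideration. -/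
inductive Kind
  | unif
  | bdd

/-- `𝒜_u(B_X)` or `ℋ^∞(B_X)`. -/
def alg (X : Type*) [NormedAddCommGroup X] [NormedSpace ℂ X] :
    Kind → Subalgebra ℂ (BoundedContinuousFunction (Ball X) ℂ)
  | .unif => Au X
  | .bdd => Hinf X

/-- The spectrum `ℳ(𝒜)`: nonzero continuous complex homomorphisms of `𝒜`. -/
abbrev Spectrum (X : Type*) [NormedAddCommGroup X] [NormedSpace ℂ X] (k : Kind) : Type _ :=
  WeakDual.characterSpace ℂ (alg X k)

/-- The Gleason metric `‖φ - ψ‖` (norm of `𝒜*`). -/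
def gleasonDist {k : Kind} (φ ψ : Spectrum X k) : ℝ :=
  ‖WeakDual.toStrongDual (φ : WeakDual ℂ (alg X k)) -
    WeakDual.toStrongDual (ψ : WeakDual ℂ (alg X k))‖

lemma norm_apply_ball_le (ℓ : StrongDual ℂ X) (x : Ball X) : ‖ℓ x‖ ≤ ‖ℓ‖ :=
  (ℓ.le_opNorm x).trans (by
    have : ‖(x : X)‖ ≤ 1 := (mem_ball_zero_iff.1 x.2).le
    nlinarith [norm_nonneg ℓ])

/-- The restriction to the open unit ball of a continuous linear functional. -/
def dualFun (ℓ : StrongDual ℂ X) : BoundedContinuousFunction (Ball X) ℂ :=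
  BoundedContinuousFunction.ofNormedAddCommGroup (fun x : Ball X => ℓ x)
    (ℓ.continuous.comp continuous_subtype_val) ‖ℓ‖
    (norm_apply_ball_le ℓ)

lemma dualFun_mem (k : Kind) (ℓ : StrongDual ℂ X) : dualFun ℓ ∈ alg X k := by
  have h : Holomorphic (dualFun ℓ) :=
    holomorphic_of ℓ (ℓ.analyticOnNhd _) fun _ => rfl
  cases k with
  | unif => exact ⟨h, ℓ.uniformContinuous.comp uniformContinuous_subtype_val⟩
  | bdd => exact h

/-- The inclusion `X* ⊆ 𝒜`. -/
def dualIncl (k : Kind) : StrongDual ℂ X →L[ℂ] alg X k :=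
  LinearMap.mkContinuous
    { toFun := fun ℓ => ⟨dualFun ℓ, dualFun_mem k ℓ⟩
      map_add' := fun _ _ => rfl
      map_smul' := fun _ _ => rfl } 1 fun ℓ => by
    rw [one_mul]
    exact BoundedContinuousFunction.norm_ofNormedAddCommGroup_le _ (norm_nonneg ℓ)
      (norm_apply_ball_le ℓ)

/-- The projection `π(φ) = φ|_{X*}` from the spectrum to the bidual. -/
def proj {k : Kind} (φ : Spectrum X k) : Bidual X :=
  (WeakDual.toStrongDual (φ : WeakDual ℂ (alg X k))).comp (dualIncl k)

/-- The fiber `ℳ_z` of the spectrum over a point `z` of the bidual. -/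
def fiber (k : Kind) (z : Bidual X) : Set (Spectrum X k) := {φ | proj φ = z}

/-- A (biholomorphic) automorphism of the open unit ball. -/
structure Automorphism (X : Type*) [NormedAddCommGroup X] [NormedSpace ℂ X] where
  toEquiv : Ball X ≃ Ball X
  holo : Holomorphic fun x => (toEquiv x : X)
  holo_symm : Holomorphic fun x => (toEquiv.symm x : X)

/-- The inverse automorphism. -/
def Automorphism.symm (Φ : Automorphism X) : Automorphism X :=
  ⟨Φ.toEquiv.symm, Φ.holo_symm, Φ.holo⟩

lemma Holomorphic.continuous (f : Ball X → X) (hf : Holomorphic f) : Continuous f := by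
  have h := continuousOn_iff_continuous_domRestrict.1 (AnalyticOnNhd.continuousOn hf)
  refine h.congr fun x => ?_
  exact zeroExt_coe f x

lemma Automorphism.continuous (Φ : Automorphism X) : Continuous Φ.toEquiv :=
  continuous_induced_rng.2 (Holomorphic.continuous _ Φ.holo)

/-- The function `f ∘ Φ`, for `f` bounded and continuous on the ball. -/
def pullback (Φ : Automorphism X) (f : BoundedContinuousFunction (Ball X) ℂ) :
    BoundedContinuousFunction (Ball X) ℂ :=
  f.compContinuous ⟨Φ.toEquiv, Φ.continuous⟩

/-- `f ∘ Φ ∈ 𝒜` for every `f ∈ 𝒜`. -/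
def Preserves (k : Kind) (Φ : Automorphism X) : Prop := ∀ f ∈ alg X k, pullback Φ f ∈ alg X k

/-- The composition operator `C_Φ : 𝒜 → 𝒜`, `C_Φ f = f ∘ Φ`. -/
def compOp {k : Kind} {Φ : Automorphism X} (h : Preserves k Φ) : alg X k →A[ℂ] alg X k where
  toFun f := ⟨pullback Φ f.1, h f.1 f.2⟩
  map_one' := rfl
  map_mul' _ _ := rfl
  map_zero' := rfl
  map_add' _ _ := rfl
  commutes' _ := rfl
  cont := (BoundedContinuousFunction.continuous_compContinuous _).comp
    continuous_subtype_val |>.subtype_mk _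

/-- The restriction of the transpose of `C_Φ` to the spectrum, `Λ_Φ φ = φ ∘ C_Φ`. -/
def spectrumMap {k : Kind} {Φ : Automorphism X} (h : Preserves k Φ) (φ : Spectrum X k) :
    Spectrum X k :=
  ⟨StrongDual.toWeakDual ((WeakDual.toStrongDual (φ : WeakDual ℂ (alg X k))).comp
      (compOp h).toContinuousLinearMap), by
    refine WeakDual.CharacterSpace.eq_set_map_one_map_mul.symm.subset ⟨?_, fun f g => ?_⟩
    · exact map_one φ
    · exact map_mul φ (compOp h f) (compOp h g)⟩

/-- The finite type polynomials on `X`: the (unital) algebra of functions generated by `X*`. -/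
def finiteType (X : Type*) [NormedAddCommGroup X] [NormedSpace ℂ X] : Subalgebra ℂ (X → ℂ) :=
  Algebra.adjoin ℂ (Set.range fun (ℓ : StrongDual ℂ X) (x : X) => ℓ x)

/-- `f` is a uniform limit, on the open unit ball, of finite type polynomials. -/
def IsUniformLimitFiniteType (f : Ball X → ℂ) : Prop :=
  ∃ Q : ℕ → X → ℂ, (∀ n, Q n ∈ finiteType X) ∧
    TendstoUniformly (fun n (x : Ball X) => Q n x) f Filter.atTop

/-- `X` is symmetrically regular: every symmetric continuous linear `T : X → X*` is weakly
compact, i.e. maps the closed unit ball to a relatively weakly compact set. -/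
def SymmetricallyRegular (X : Type*) [NormedAddCommGroup X] [NormedSpace ℂ X] : Prop :=
  ∀ T : X →L[ℂ] StrongDual ℂ X, (∀ x y, T x y = T y x) →
    IsCompact (closure (toWeakSpace ℂ (StrongDual ℂ X) '' (T '' closedBall (0 : X) 1)))

/-- The value on the diagonal `(z, …, z)` of the Aron–Berner extension to the bidual of an
`n`-linear form `A` on `X`, i.e. the iterated weak-star limit of `A (x₁, …, xₙ)` as first
`xₙ → z`, then `xₙ₋₁ → z`, …, and finally `x₁ → z`. The outermost limit is obtained by applying
`z` to the functional which sends `x` to the extension of `A (x, ·)`. -/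
def aronBerner (z : Bidual X) :
    (n : ℕ) → ContinuousMultilinearMap ℂ (fun _ : Fin n => X) ℂ →L[ℂ] ℂ
  | 0 => ContinuousMultilinearMap.apply ℂ (fun _ : Fin 0 => X) ℂ 0
  | n + 1 => z.comp ((ContinuousLinearMap.compL ℂ X
        (ContinuousMultilinearMap ℂ (fun _ : Fin n => X) ℂ) ℂ (aronBerner z n)).comp
      ((continuousMultilinearCurryLeftEquiv ℂ (fun _ : Fin (n + 1) => X) ℂ).toContinuousLinearEquiv :
        ContinuousMultilinearMap ℂ (fun _ : Fin (n + 1) => X) ℂ →L[ℂ]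
          X →L[ℂ] ContinuousMultilinearMap ℂ (fun _ : Fin n => X) ℂ))

/-- The canonical extension `f̃(z) = ∑ₙ P̃ₙ(z)` to the open unit ball of the bidual of a bounded
holomorphic function `f = ∑ₙ Pₙ` on the open unit ball of `X`, where `Pₙ` is the `n`-th Taylor
polynomial of `f` at `0` and `P̃ₙ` its Aron–Berner extension. -/
def canonicalExt (f : Ball X → ℂ) (z : Bidual X) : ℂ :=
  ∑' n : ℕ, ((n.factorial : ℂ))⁻¹ * aronBerner z n (iteratedFDeriv ℂ n (zeroExt f) 0)

/-- `Ψ` is the canonical extension `Φ̃` of `Φ` to the closed unit ball of the bidual: on the open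
unit ball of `X**` it is given by `Φ̃(z)(x*) = (x* ∘ Φ)~(z)`, and it is weak-star continuous on the
closed unit ball. -/
def IsCanonicalExtension (Φ : Automorphism X) (Ψ : C(BidualBall X, BidualBall X)) : Prop :=
  ∀ z : BidualBall X, ‖bidualPt z‖ < 1 → ∀ ℓ : StrongDual ℂ X,
    bidualPt (Ψ z) ℓ = canonicalExt (fun x => ℓ (Φ.toEquiv x)) (bidualPt z)

/-- `Φ'` is a continuous extension of `Φ` to the closed unit ball of `X`. -/
def IsContinuousExtension (Φ : Automorphism X) (Φ' : C(ClosedBall X, ClosedBall X)) : Prop :=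
  ∀ x : Ball X, (Φ' ⟨x, ball_subset_closedBall x.2⟩ : X) = Φ.toEquiv x

/-- `Φ'` is a norm-to-weak-star continuous extension of `Φ` to the closed unit ball of `X`, with
values in the closed unit ball of `X**`. -/
def IsWeakStarExtension (Φ : Automorphism X) (Φ' : C(ClosedBall X, BidualBall X)) : Prop :=
  ∀ x : Ball X, bidualPt (Φ' ⟨x, ball_subset_closedBall x.2⟩) = toBidual (Φ.toEquiv x : X)

end BallAlgebra

end

/-!
The restriction map `π : φ ↦ φ|_{X*}` is a weak-star continuous map from the compact space `ℳ(𝒜)`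
to the closed unit ball of `X**`. Its range contains `B_X`, by evaluations, so `π` is onto by
Goldstine's theorem, and therefore a quotient map. A character is determined on finite type
polynomials, hence on their uniform limits, by its image under `π`. If all `x* ∘ Φ` are such
limits, `π (Λ_Φ φ)` thus depends only on `π φ`, so `Λ_Φ` descends to a weak-star continuous
self-map of the closed unit ball of `X**`, which extends `Φ`; since `Λ_Φ` is bijective, and the same
applies to `Φ⁻¹`, it maps fibers of `π` onto fibers. To identify the induced map with `Φ̃` one
checks that `φ f = f̃ (π φ)` for `‖π φ‖ < 1` and `f` a uniform limit of finite type polynomials: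
for a polynomial this is its Taylor expansion along the line through `π φ`, and the Cauchy
estimates allow the passage to the limit.
-/

noncomputable section

namespace BallAlgebra

open Filter Topology

section WeakTopology

variable {𝕜 E F : Type*} [RCLike 𝕜]

lemma norm_le_of_forall_ball_re_le [NormedAddCommGroup E] [NormedSpace 𝕜 E]
    (ℓ : StrongDual 𝕜 E) {u : ℝ} (h : ∀ x ∈ ball (0 : E) 1, RCLike.re (ℓ x) ≤ u) : ‖ℓ‖ ≤ u := by
  refine le_of_forall_lt fun r hr => ?_
  obtain ⟨x, hx, hrx⟩ := ContinuousLinearMap.exists_lt_apply_of_lt_opNorm ℓ hr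
  obtain ⟨c, hc, hcx⟩ := RCLike.exists_norm_eq_mul_self (ℓ x)
  have hre := h (c • x) (by rwa [mem_ball_zero_iff, norm_smul, hc, one_mul])
  rw [map_smul, smul_eq_mul, ← hcx, RCLike.ofReal_re] at hre
  exact hrx.trans_le hre

lemma mem_closure_weakBilin_of_forall_re_le [AddCommGroup E] [Module 𝕜 E] [Module ℝ E]
    [IsScalarTower ℝ 𝕜 E] [AddCommGroup F] [Module 𝕜 F] (B : E →ₗ[𝕜] F →ₗ[𝕜] 𝕜)
    {s : Set E} (hs : Convex ℝ s) {x : E}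
    (h : ∀ (y : F) (u : ℝ), (∀ a ∈ s, RCLike.re (B a y) ≤ u) → RCLike.re (B x y) ≤ u) :
    x ∈ closure (X := WeakBilin B) s := by
  by_contra hx
  have : ContinuousSMul ℝ (WeakBilin B) := IsScalarTower.continuousSMul 𝕜
  have hs' : Convex (E := WeakBilin B) ℝ s := hs
  obtain ⟨g, u, hg, hu⟩ :=
    RCLike.geometric_hahn_banach_closed_point (𝕜 := 𝕜) hs'.closure isClosed_closure hx
  obtain ⟨y, rfl⟩ := LinearMap.dualEmbedding_surjective B g
  exact (h y u fun a ha => (hg a (subset_closure ha)).le).not_gt hu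

end WeakTopology

section CharacterSpace

variable {𝕜 A : Type*} [NontriviallyNormedField 𝕜] [SeminormedRing A] [NormedAlgebra 𝕜 A]

/- If `‖a‖ < ‖φ a‖`, the powers of `(φ a)⁻¹ • a` tend to `0`, while `φ` is `1` on all of them. -/
lemma norm_character_apply_le (φ : WeakDual.characterSpace 𝕜 A) (a : A) : ‖φ a‖ ≤ ‖a‖ := by
  by_contra! hlt
  have hne : φ a ≠ 0 := norm_pos_iff.1 ((norm_nonneg a).trans_lt hlt)
  have hnorm : ‖(φ a)⁻¹ • a‖ < 1 := by
    rwa [norm_smul, norm_inv, inv_mul_lt_one₀ (norm_pos_iff.2 hne)]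
  have hzero : Tendsto (fun n : ℕ => φ (((φ a)⁻¹ • a) ^ n)) atTop (𝓝 (φ 0)) :=
    ((map_continuous φ).tendsto 0).comp (tendsto_pow_atTop_nhds_zero_of_norm_lt_one hnorm)
  have hone (n : ℕ) : φ (((φ a)⁻¹ • a) ^ n) = 1 := by
    rw [map_pow, map_smul, smul_eq_mul, inv_mul_cancel₀ hne, one_pow]
  simp only [hone, map_zero] at hzero
  exact one_ne_zero (tendsto_nhds_unique tendsto_const_nhds hzero)

instance compactSpace_characterSpace [ProperSpace 𝕜] :
    CompactSpace (WeakDual.characterSpace 𝕜 A) := by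
  rw [← isCompact_iff_compactSpace]
  refine (WeakDual.isCompact_closedBall (𝕜 := 𝕜) (0 : StrongDual 𝕜 A) 1).of_isClosed_subset
    WeakDual.CharacterSpace.isClosed fun φ hφ => ?_
  rw [Set.mem_preimage, mem_closedBall_zero_iff]
  refine ContinuousLinearMap.opNorm_le_bound _ zero_le_one fun a => ?_
  rw [one_mul]
  exact norm_character_apply_le ⟨φ, hφ⟩ a

lemma continuous_character_apply (a : A) :
    Continuous fun φ : WeakDual.characterSpace 𝕜 A => φ a :=
  (WeakDual.eval_continuous a).comp continuous_subtype_val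

end CharacterSpace

section CauchyEstimates

variable {E F : Type*} [NormedAddCommGroup E] [NormedSpace ℂ E] [NormedAddCommGroup F]
  [NormedSpace ℂ F]

lemma norm_fderiv_le_of_forall_mem_ball_norm_le {f : E → F} {x : E} {r M : ℝ} (hr : 0 < r)
    (hf : DifferentiableOn ℂ f (ball x r)) (hM : ∀ y ∈ ball x r, ‖f y‖ ≤ M) :
    ‖fderiv ℂ f x‖ ≤ 2 * M / r := by
  refine Complex.norm_fderiv_le_div_of_mapsTo_ball hf (fun y hy => ?_) hr
  rw [mem_closedBall, dist_eq_norm]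
  linarith [norm_sub_le (f y) (f x), hM y hy, hM x (mem_ball_self hr)]

variable [CompleteSpace F]

lemma norm_iteratedFDeriv_le_of_forall_mem_ball_norm_le {f : E → F} {M : ℝ} (n : ℕ) :
    ∀ {x : E} {r : ℝ}, 0 < r → AnalyticOnNhd ℂ f (ball x r) → (∀ y ∈ ball x r, ‖f y‖ ≤ M) →
      ‖iteratedFDeriv ℂ n f x‖ ≤ (2 * (n + 1) / r) ^ n * M := by
  induction n with
  | zero => exact fun hr _ hM => by simpa using hM _ (mem_ball_self hr)
  | succ n ih =>
    intro x r hr hf hM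
    -- Radius `s` for the `(n + 1)`-st derivative leaves `(n + 1) * s` for the first `n`.
    set s : ℝ := r / (n + 2) with hs
    have hs0 : 0 < s := by positivity
    have hsub {y : E} (hy : y ∈ ball x s) : ball y ((n + 1) * s) ⊆ ball x r := by
      refine ball_subset_ball' ?_
      have hrs : r = (n + 2) * s := by rw [hs]; field_simp
      linarith [mem_ball.1 hy]
    have hsr : ball x s ⊆ ball x r := fun y hy => hsub hy (mem_ball_self (by positivity))
    have hn : ∀ y ∈ ball x s, ‖iteratedFDeriv ℂ n f y‖ ≤ (2 / s) ^ n * M := fun y hy => by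
      have h := ih (by positivity) (hf.mono (hsub hy)) fun z hz => hM z (hsub hy hz)
      rwa [mul_comm 2, mul_div_mul_left _ _ (by positivity)] at h
    rw [← norm_fderiv_iteratedFDeriv]
    calc ‖fderiv ℂ (iteratedFDeriv ℂ n f) x‖ ≤ 2 * ((2 / s) ^ n * M) / s :=
        norm_fderiv_le_of_forall_mem_ball_norm_le hs0
          ((hf.iteratedFDeriv n).differentiableOn.mono hsr) hn
      _ = (2 / s) ^ (n + 1) * M := by ring
      _ = (2 * (↑(n + 1) + 1) / r) ^ (n + 1) * M := by
        rw [hs, div_div_eq_mul_div]; push_cast; ring_nf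

lemma tendsto_iteratedFDeriv_of_tendstoUniformlyOn {ι : Type*} {l : Filter ι} {G : ι → E → F}
    {g : E → F} {x : E} {r : ℝ} (hr : 0 < r) (hG : ∀ i, AnalyticOnNhd ℂ (G i) (ball x r))
    (hg : AnalyticOnNhd ℂ g (ball x r)) (hlim : TendstoUniformlyOn G g l (ball x r)) (n : ℕ) :
    Tendsto (fun i => iteratedFDeriv ℂ n (G i) x) l (𝓝 (iteratedFDeriv ℂ n g x)) := by
  have hx : x ∈ ball x r := mem_ball_self hr
  set C : ℝ := (2 * (n + 1) / r) ^ n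
  have hC0 : 0 < C := by positivity
  rw [Metric.tendstoUniformlyOn_iff] at hlim
  rw [Metric.tendsto_nhds]
  intro ε hε
  filter_upwards [hlim (ε / (2 * C)) (by positivity)] with i hi
  rw [dist_comm, dist_eq_norm, ← iteratedFDeriv_sub_apply (hg x hx).contDiffAt
    (hG i x hx).contDiffAt]
  calc ‖iteratedFDeriv ℂ n (g - G i) x‖ ≤ C * (ε / (2 * C)) :=
      norm_iteratedFDeriv_le_of_forall_mem_ball_norm_le n hr (hg.sub (hG i)) fun y hy => by
        simpa only [Pi.sub_apply, ← dist_eq_norm] using (hi y hy).le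
    _ < ε := by field_simp; norm_num

end CauchyEstimates

variable {X : Type*} [NormedAddCommGroup X] [NormedSpace ℂ X]

/-! ### The projection of the spectrum onto the bidual ball -/

/-- The inclusion of the open unit ball into the closed one. -/
def ballIncl : Ball X → ClosedBall X := Set.inclusion ball_subset_closedBall

lemma bidualPt_injective : Function.Injective (bidualPt : BidualBall X → Bidual X) :=
  fun _ _ h => Subtype.ext (WeakDual.toStrongDual.injective h)

lemma continuous_bidualBall_of_continuous_eval {α : Type*} [TopologicalSpace α]
    {g : α → BidualBall X} (hg : ∀ ℓ : StrongDual ℂ X, Continuous fun a => bidualPt (g a) ℓ) :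
    Continuous g :=
  Continuous.subtype_mk (WeakDual.continuous_of_continuous_eval hg) _

lemma norm_toBidual_le (x : X) : ‖toBidual x‖ ≤ ‖x‖ :=
  NormedSpace.double_dual_bound ℂ X x

/-- The canonical map from the closed unit ball of `X`, with the norm topology, to that of the
bidual, with the weak-star topology. -/
def closedBallToBidual : C(ClosedBall X, BidualBall X) where
  toFun x := ⟨StrongDual.toWeakDual (toBidual (x : X)),
    (norm_toBidual_le (x : X)).trans (mem_closedBall_zero_iff.1 x.2)⟩
  continuous_toFun := continuous_bidualBall_of_continuous_eval fun ℓ =>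
    ℓ.continuous.comp continuous_subtype_val

/-- **Goldstine's theorem**. -/
theorem denseRange_closedBallToBidual_ballIncl :
    DenseRange fun x : Ball X => closedBallToBidual (ballIncl x) := by
  intro z
  have hconv : Convex ℝ (toBidual '' ball (0 : X) 1) :=
    (convex_ball (0 : X) 1).linear_image
      ((NormedSpace.inclusionInDoubleDual ℂ X).toLinearMap.restrictScalars ℝ)
  have hmem := mem_closure_weakBilin_of_forall_re_le (topDualPairing ℂ (StrongDual ℂ X)) hconv
      (x := bidualPt z) <| by
    intro ℓ u hu
    have hz : ‖bidualPt z ℓ‖ ≤ ‖ℓ‖ := by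
      simpa using (bidualPt z).le_of_opNorm_le z.2 ℓ
    have hℓ : ‖ℓ‖ ≤ u := norm_le_of_forall_ball_re_le ℓ fun x hx =>
      hu (toBidual x) (Set.mem_image_of_mem _ hx)
    exact (Complex.re_le_norm _).trans (hz.trans hℓ)
  rw [closure_subtype]
  refine closure_mono (X := WeakDual ℂ (StrongDual ℂ X)) ?_ hmem
  rintro _ ⟨x, hx, rfl⟩
  exact ⟨_, ⟨⟨x, hx⟩, rfl⟩, rfl⟩

lemma norm_proj_le {k : Kind} (φ : Spectrum X k) : ‖proj φ‖ ≤ 1 :=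
  ContinuousLinearMap.opNorm_le_bound _ zero_le_one fun ℓ =>
    (norm_character_apply_le φ (dualIncl k ℓ)).trans <|
      (dualIncl k).le_of_opNorm_le (LinearMap.mkContinuous_norm_le _ zero_le_one _) ℓ

/-- The projection `proj`, as a continuous map onto the closed unit ball of the bidual. -/
def projBall (k : Kind) : C(Spectrum X k, BidualBall X) where
  toFun φ := ⟨StrongDual.toWeakDual (proj φ), norm_proj_le φ⟩
  continuous_toFun := continuous_bidualBall_of_continuous_eval fun ℓ =>
    continuous_character_apply (dualIncl k ℓ)

lemma mem_fiber_bidualPt {k : Kind} {φ : Spectrum X k} {z : BidualBall X} :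
    φ ∈ fiber k (bidualPt z) ↔ projBall k φ = z :=
  bidualPt_injective.eq_iff (a := projBall k φ)

/-- The evaluation at a point of the ball, as a point of the spectrum. -/
def evalChar (k : Kind) (x : Ball X) : Spectrum X k :=
  ⟨StrongDual.toWeakDual ((BoundedContinuousFunction.evalCLM ℂ x).comp
      (Subalgebra.toSubmodule (alg X k)).subtypeL),
    WeakDual.CharacterSpace.eq_set_map_one_map_mul.symm.subset ⟨rfl, fun _ _ => rfl⟩⟩

lemma projBall_evalChar (k : Kind) (x : Ball X) :
    projBall k (evalChar k x) = closedBallToBidual (ballIncl x) := rfl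

theorem surjective_projBall (k : Kind) : Function.Surjective (projBall (X := X) k) := by
  rw [← Set.range_eq_univ,
    ← (isCompact_range (projBall (X := X) k).continuous).isClosed.closure_eq]
  refine (denseRange_closedBallToBidual_ballIncl.mono ?_).closure_eq
  rintro _ ⟨x, rfl⟩
  exact ⟨evalChar k x, projBall_evalChar k x⟩

lemma isQuotientMap_projBall (k : Kind) : IsQuotientMap (projBall (X := X) k) :=
  have hcont : Continuous (projBall (X := X) k) := (projBall k).continuous
  hcont.isClosedMap.isQuotientMap hcont (surjective_projBall k)

/-! ### Composition operators -/

lemma Holomorphic.comp_automorphism {E : Type*} [NormedAddCommGroup E] [NormedSpace ℂ E]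
    {f : Ball X → E} (hf : Holomorphic f) (Φ : Automorphism X) :
    Holomorphic fun x => f (Φ.toEquiv x) := by
  refine holomorphic_of (fun x => zeroExt f (zeroExt (fun y => (Φ.toEquiv y : X)) x)) ?_ ?_
  · refine AnalyticOnNhd.comp hf Φ.holo fun x hx => ?_
    rw [zeroExt_coe _ ⟨x, hx⟩]
    exact (Φ.toEquiv ⟨x, hx⟩).2
  · intro x
    rw [zeroExt_coe, zeroExt_coe]

lemma preserves_of_uniformContinuous (k : Kind) (Φ : Automorphism X)
    (hΦ : k = Kind.unif → UniformContinuous Φ.toEquiv) : Preserves k Φ := by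
  intro f hf
  cases k with
  | unif => exact ⟨hf.1.comp_automorphism Φ, hf.2.comp (hΦ rfl)⟩
  | bdd => exact Holomorphic.comp_automorphism hf Φ

section SpectrumMap

variable {k : Kind} {Φ : Automorphism X} (h : Preserves k Φ) (h' : Preserves k Φ.symm)

lemma compOp_compOp_symm (f : alg X k) : compOp h (compOp h' f) = f :=
  Subtype.ext <| BoundedContinuousFunction.ext fun x =>
    congrArg f.1 (Φ.toEquiv.symm_apply_apply x)

lemma norm_compOp_le (f : alg X k) : ‖compOp h f‖ ≤ ‖f‖ :=
  f.1.norm_compContinuous_le _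

lemma spectrumMap_apply (φ : Spectrum X k) (f : alg X k) :
    spectrumMap h φ f = φ (compOp h f) := rfl

lemma continuous_spectrumMap : Continuous (spectrumMap h) :=
  Continuous.subtype_mk (WeakDual.continuous_of_continuous_eval fun f =>
    continuous_character_apply (compOp h f)) _

lemma leftInverse_spectrumMap : Function.LeftInverse (spectrumMap h') (spectrumMap h) :=
  fun φ => WeakDual.CharacterSpace.ext fun f => by
    rw [spectrumMap_apply, spectrumMap_apply, compOp_compOp_symm]

lemma rightInverse_spectrumMap : Function.RightInverse (spectrumMap h') (spectrumMap h) :=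
  leftInverse_spectrumMap (Φ := Φ.symm) h' h

lemma gleasonDist_spectrumMap_le (φ ψ : Spectrum X k) :
    gleasonDist (spectrumMap h φ) (spectrumMap h ψ) ≤ gleasonDist φ ψ :=
  ContinuousLinearMap.opNorm_le_bound _ (norm_nonneg (_ : StrongDual ℂ (alg X k))) fun f =>
    (ContinuousLinearMap.le_opNorm (WeakDual.toStrongDual (φ : WeakDual ℂ (alg X k)) -
      WeakDual.toStrongDual (ψ : WeakDual ℂ (alg X k))) (compOp h f)).trans <|
        mul_le_mul_of_nonneg_left (norm_compOp_le h f) (norm_nonneg _)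

include h' in
theorem gleasonDist_spectrumMap (φ ψ : Spectrum X k) :
    gleasonDist (spectrumMap h φ) (spectrumMap h ψ) = gleasonDist φ ψ := by
  refine (gleasonDist_spectrumMap_le h φ ψ).antisymm ?_
  simpa only [leftInverse_spectrumMap h h' _] using
    gleasonDist_spectrumMap_le h' (spectrumMap h φ) (spectrumMap h ψ)

end SpectrumMap

/-! ### Finite type polynomials -/

/-- The value at a point of the bidual of a polynomial expression in functionals. -/
def polyEval (z : Bidual X) : MvPolynomial (StrongDual ℂ X) ℂ →ₐ[ℂ] ℂ :=
  MvPolynomial.aeval fun ℓ => z ℓ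

/-- The finite type polynomial on `X` given by a polynomial expression in functionals. -/
def polyFun (p : MvPolynomial (StrongDual ℂ X) ℂ) (x : X) : ℂ := polyEval (toBidual x) p

/-- The element of `𝒜` given by a polynomial expression in functionals. -/
def polyAlg (k : Kind) : MvPolynomial (StrongDual ℂ X) ℂ →ₐ[ℂ] alg X k :=
  MvPolynomial.aeval fun ℓ => dualIncl k ℓ

lemma exists_polyFun_eq {Q : X → ℂ} (hQ : Q ∈ finiteType X) :
    ∃ p : MvPolynomial (StrongDual ℂ X) ℂ, polyFun p = Q := by
  rw [finiteType, Algebra.adjoin_range_eq_range_aeval] at hQ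
  obtain ⟨p, rfl⟩ := hQ
  exact ⟨p, funext fun x =>
    (MvPolynomial.comp_aeval_apply _ (Pi.evalAlgHom ℂ (fun _ : X => ℂ) x) p).symm⟩

lemma character_polyAlg {k : Kind} (φ : Spectrum X k) (p : MvPolynomial (StrongDual ℂ X) ℂ) :
    φ (polyAlg k p) = polyEval (proj φ) p :=
  MvPolynomial.comp_aeval_apply (fun ℓ : StrongDual ℂ X => dualIncl k ℓ)
    (AlgHomClass.toAlgHom φ) p

lemma polyAlg_apply (k : Kind) (p : MvPolynomial (StrongDual ℂ X) ℂ) (x : Ball X) :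
    (polyAlg k p).1 x = polyFun p x :=
  character_polyAlg (evalChar k x) p

lemma norm_polyEval_le (k : Kind) {z : Bidual X} (hz : ‖z‖ ≤ 1)
    (p : MvPolynomial (StrongDual ℂ X) ℂ) : ‖polyEval z p‖ ≤ ‖polyAlg k p‖ := by
  obtain ⟨φ, hφ⟩ := surjective_projBall k ⟨StrongDual.toWeakDual z, hz⟩
  have hproj : proj φ = z := congrArg bidualPt hφ
  rw [← hproj, ← character_polyAlg]
  exact norm_character_apply_le φ _

lemma analyticOnNhd_polyFun (p : MvPolynomial (StrongDual ℂ X) ℂ) (s : Set X) :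
    AnalyticOnNhd ℂ (polyFun p) s :=
  AnalyticOnNhd.aeval_mvPolynomial (fun ℓ => ℓ.analyticOnNhd s) p

/-- The derivative of a polynomial expression in the direction of a point of the bidual. -/
def dirDeriv (w : Bidual X) :
    Derivation ℂ (MvPolynomial (StrongDual ℂ X) ℂ) (MvPolynomial (StrongDual ℂ X) ℂ) :=
  MvPolynomial.mkDerivation ℂ fun ℓ => MvPolynomial.C (w ℓ)

/- The point of the statement is that one functional `L` computes the derivatives in all
directions `w` of the bidual. -/
lemma exists_hasFDerivAt_aeval {E : Type*} [NormedAddCommGroup E] [NormedSpace ℂ E]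
    (u : StrongDual ℂ X →ₗ[ℂ] StrongDual ℂ E) (p : MvPolynomial (StrongDual ℂ X) ℂ) (e : E) :
    ∃ L : StrongDual ℂ X,
      HasFDerivAt (fun e => MvPolynomial.aeval (fun ℓ => u ℓ e) p) (u L) e ∧
      ∀ w : Bidual X, w L = MvPolynomial.aeval (fun ℓ => u ℓ e) (dirDeriv w p) := by
  induction p using MvPolynomial.induction_on with
  | C a =>
    refine ⟨0, ?_, fun w => by simp [dirDeriv]⟩
    simpa only [MvPolynomial.aeval_C, map_zero] using hasFDerivAt_const _ _
  | add p q hp hq =>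
    obtain ⟨L, hL, hwL⟩ := hp
    obtain ⟨M, hM, hwM⟩ := hq
    refine ⟨L + M, ?_, fun w => by simp only [map_add, hwL, hwM]⟩
    simpa only [map_add] using hL.fun_add hM
  | mul_X p ℓ hp =>
    obtain ⟨L, hL, hwL⟩ := hp
    refine ⟨MvPolynomial.aeval (fun ℓ => u ℓ e) p • ℓ + u ℓ e • L, ?_, fun w => ?_⟩
    · simpa only [map_mul, MvPolynomial.aeval_X, map_add, map_smul] using
        hL.fun_mul (u ℓ).hasFDerivAt
    · rw [map_add, map_smul, map_smul, hwL]
      simp [dirDeriv, Derivation.leibniz]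

lemma hasDerivAt_polyEval_smul (w : Bidual X) (p : MvPolynomial (StrongDual ℂ X) ℂ) (t : ℂ) :
    HasDerivAt (fun t : ℂ => polyEval (t • w) p) (polyEval (t • w) (dirDeriv w p)) t := by
  obtain ⟨L, hL, hwL⟩ :=
    exists_hasFDerivAt_aeval (w.toLinearMap.smulRight (1 : StrongDual ℂ ℂ)) p t
  have heval (s : ℂ) (q : MvPolynomial (StrongDual ℂ X) ℂ) :
      MvPolynomial.aeval (fun ℓ => w.toLinearMap.smulRight (1 : StrongDual ℂ ℂ) ℓ s) q =
        polyEval (s • w) q :=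
    congrArg (fun v => MvPolynomial.aeval v q) (funext fun ℓ => mul_comm (w ℓ) s)
  simp only [heval] at hL hwL
  simpa [hwL] using hL.hasDerivAt

lemma differentiable_polyEval_smul (w : Bidual X) (p : MvPolynomial (StrongDual ℂ X) ℂ) :
    Differentiable ℂ fun t : ℂ => polyEval (t • w) p :=
  fun t => (hasDerivAt_polyEval_smul w p t).differentiableAt

lemma exists_hasFDerivAt_polyFun (p : MvPolynomial (StrongDual ℂ X) ℂ) (x : X) :
    ∃ L : StrongDual ℂ X, HasFDerivAt (polyFun p) L x ∧
      ∀ w : Bidual X, w L = polyFun (dirDeriv w p) x :=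
  exists_hasFDerivAt_aeval LinearMap.id p x

lemma iteratedDeriv_polyEval_smul (w : Bidual X) (p : MvPolynomial (StrongDual ℂ X) ℂ) (n : ℕ) :
    iteratedDeriv n (fun t : ℂ => polyEval (t • w) p) =
      fun t => polyEval (t • w) ((dirDeriv w)^[n] p) := by
  induction n generalizing p with
  | zero => rw [iteratedDeriv_zero, Function.iterate_zero_apply]
  | succ n ih =>
    rw [iteratedDeriv_succ', Function.iterate_succ_apply, ← ih]
    exact congrArg _ (funext fun t => (hasDerivAt_polyEval_smul w p t).deriv)

/-! ### Canonical extensions -/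

/-- The value at `z` of the Aron–Berner extension `P̃ₙ` of the `n`-th Taylor polynomial
`Pₙ = (n!)⁻¹ • Dⁿ F(0)` of `F` at `0`. -/
def aronBernerTaylor (F : X → ℂ) (z : Bidual X) (n : ℕ) : ℂ :=
  (n.factorial : ℂ)⁻¹ * aronBerner z n (iteratedFDeriv ℂ n F 0)

lemma aronBerner_iteratedFDeriv_succ (z : Bidual X) (n : ℕ) {F : X → ℂ} {x : X}
    (hF : DifferentiableAt ℂ (iteratedFDeriv ℂ n F) x) :
    aronBerner z (n + 1) (iteratedFDeriv ℂ (n + 1) F x) =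
      z (fderiv ℂ (fun y => aronBerner z n (iteratedFDeriv ℂ n F y)) x) := by
  have hcomp : fderiv ℂ (fun y => aronBerner z n (iteratedFDeriv ℂ n F y)) x =
      (aronBerner z n).comp (fderiv ℂ (iteratedFDeriv ℂ n F) x) :=
    ((aronBerner z n).hasFDerivAt.comp x hF.hasFDerivAt).fderiv
  rw [hcomp]
  rfl

lemma aronBerner_iteratedFDeriv_polyFun (z : Bidual X) (p : MvPolynomial (StrongDual ℂ X) ℂ)
    (n : ℕ) (x : X) :
    aronBerner z n (iteratedFDeriv ℂ n (polyFun p) x) = polyFun ((dirDeriv z)^[n] p) x := by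
  induction n generalizing x with
  | zero => rfl
  | succ n ih =>
    obtain ⟨L, hL, hzL⟩ := exists_hasFDerivAt_polyFun ((dirDeriv z)^[n] p) x
    rw [aronBerner_iteratedFDeriv_succ z n
      ((analyticOnNhd_polyFun p Set.univ).iteratedFDeriv n x trivial).differentiableAt]
    simp only [ih]
    rw [hL.fderiv, hzL, Function.iterate_succ_apply']

lemma aronBernerTaylor_polyFun (z : Bidual X) (p : MvPolynomial (StrongDual ℂ X) ℂ) (n : ℕ) :
    aronBernerTaylor (polyFun p) z n =
      (n.factorial : ℂ)⁻¹ * iteratedDeriv n (fun t : ℂ => polyEval (t • z) p) 0 := by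
  rw [aronBernerTaylor, aronBerner_iteratedFDeriv_polyFun, iteratedDeriv_polyEval_smul]
  simp only [polyFun, toBidual, map_zero, zero_smul ℂ z]

lemma tsum_aronBernerTaylor_polyFun (z : Bidual X) (p : MvPolynomial (StrongDual ℂ X) ℂ) :
    ∑' n, aronBernerTaylor (polyFun p) z n = polyEval z p := by
  have htaylor := Complex.taylorSeries_eq_of_entire' 0 1 (differentiable_polyEval_smul z p)
  simpa only [aronBernerTaylor_polyFun, sub_zero, one_pow, mul_one, one_smul] using htaylor

lemma norm_aronBernerTaylor_polyFun_le (k : Kind) {z : Bidual X} {ρ : ℝ} (hρ : 0 < ρ)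
    (hz : ρ * ‖z‖ ≤ 1) (p : MvPolynomial (StrongDual ℂ X) ℂ) (n : ℕ) :
    ‖aronBernerTaylor (polyFun p) z n‖ ≤ ‖polyAlg k p‖ / ρ ^ n := by
  have hsphere : ∀ t ∈ sphere (0 : ℂ) ρ, ‖polyEval (t • z) p‖ ≤ ‖polyAlg k p‖ := fun t ht => by
    refine norm_polyEval_le k ?_ p
    rwa [NormedSpace.toNormSMulClass.norm_smul t z, mem_sphere_zero_iff_norm.1 ht]
  have hcauchy := Complex.norm_iteratedDeriv_le_of_forall_mem_sphere_norm_le n hρ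
    (differentiable_polyEval_smul z p).diffContOnCl hsphere
  rw [aronBernerTaylor_polyFun, norm_mul, norm_inv, Complex.norm_natCast,
    inv_mul_le_iff₀ (by positivity), ← mul_div_assoc]
  exact hcauchy

lemma exists_tendsto_polyAlg {k : Kind} {f : alg X k} (hf : IsUniformLimitFiniteType f.1) :
    ∃ p : ℕ → MvPolynomial (StrongDual ℂ X) ℂ,
      Tendsto (fun m => polyAlg k (p m)) atTop (𝓝 f) := by
  obtain ⟨Q, hQ, hlim⟩ := hf
  choose p hp using fun m => exists_polyFun_eq (hQ m)
  refine ⟨p, tendsto_subtype_rng.2 ?_⟩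
  rw [BoundedContinuousFunction.tendsto_iff_tendstoUniformly]
  convert hlim using 3 with m x
  rw [polyAlg_apply, hp]

lemma character_eq_of_proj_eq {k : Kind} {f : alg X k} (hf : IsUniformLimitFiniteType f.1)
    {φ ψ : Spectrum X k} (hproj : proj φ = proj ψ) : φ f = ψ f := by
  obtain ⟨p, hp⟩ := exists_tendsto_polyAlg hf
  have hφ := ((map_continuous φ).tendsto f).comp hp
  have hψ := ((map_continuous ψ).tendsto f).comp hp
  refine tendsto_nhds_unique hφ (hψ.congr fun m => ?_)
  simp only [Function.comp_apply, character_polyAlg, hproj]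

lemma holomorphic_of_mem_alg {k : Kind} (f : alg X k) : Holomorphic f.1 := by
  cases k with
  | unif => exact f.2.1
  | bdd => exact f.2

lemma tendsto_aronBernerTaylor {k : Kind} {f : alg X k}
    {p : ℕ → MvPolynomial (StrongDual ℂ X) ℂ}
    (hp : Tendsto (fun m => polyAlg k (p m)) atTop (𝓝 f)) (z : Bidual X) (n : ℕ) :
    Tendsto (fun m => aronBernerTaylor (polyFun (p m)) z n) atTop
      (𝓝 (aronBernerTaylor (zeroExt f.1) z n)) := by
  have hunif : TendstoUniformlyOn (fun m => polyFun (p m)) (zeroExt f.1) atTop (ball 0 1) := by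
    have h := BoundedContinuousFunction.tendsto_iff_tendstoUniformly.1 (tendsto_subtype_rng.1 hp)
    rw [tendstoUniformlyOn_iff_tendstoUniformly_comp_coe]
    convert h using 3 with m x
    · exact (polyAlg_apply k (p m) x).symm
    · exact funext (zeroExt_coe f.1)
  have hderiv := tendsto_iteratedFDeriv_of_tendstoUniformlyOn one_pos
    (fun m => analyticOnNhd_polyFun (p m) _) (holomorphic_of_mem_alg f) hunif n
  exact (((aronBerner z n).continuous.tendsto _).comp hderiv).const_mul _

/- The identity holds for finite type polynomials, by Taylor expansion along `t ↦ t • proj φ`; since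
`‖proj φ‖ < 1`, the Cauchy estimates dominate the Taylor series by a geometric one, uniformly along
an approximating sequence. -/
theorem character_eq_canonicalExt {k : Kind} {f : alg X k} (hf : IsUniformLimitFiniteType f.1)
    (φ : Spectrum X k) (hφ : ‖proj φ‖ < 1) : φ f = canonicalExt f.1 (proj φ) := by
  obtain ⟨p, hp⟩ := exists_tendsto_polyAlg hf
  obtain ⟨ρ, hρ, hz⟩ : ∃ ρ : ℝ, 1 < ρ ∧ ρ * ‖proj φ‖ ≤ 1 := by
    obtain ⟨r, hr, hr1⟩ := exists_between hφ
    have hr0 : 0 < r := (norm_nonneg (proj φ)).trans_lt hr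
    exact ⟨r⁻¹, (one_lt_inv₀ hr0).2 hr1, (inv_mul_le_one₀ hr0).2 hr.le⟩
  have hρ0 : 0 < ρ := one_pos.trans hρ
  have hsummable : Summable fun n : ℕ => (‖f‖ + 1) / ρ ^ n := by
    simp_rw [div_eq_mul_inv, ← inv_pow]
    exact (summable_geometric_of_lt_one (by positivity) (inv_lt_one_of_one_lt₀ hρ)).mul_left _
  have hbound : ∀ᶠ m in atTop, ∀ n,
      ‖aronBernerTaylor (polyFun (p m)) (proj φ) n‖ ≤ (‖f‖ + 1) / ρ ^ n := by
    filter_upwards [hp.norm.eventually_le_const (lt_add_one ‖f‖)] with m hm n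
    exact (norm_aronBernerTaylor_polyFun_le k hρ0 hz (p m) n).trans (by gcongr)
  have hsum := tendsto_tsum_of_dominated_convergence hsummable
    (fun n => tendsto_aronBernerTaylor hp (proj φ) n) hbound
  refine tendsto_nhds_unique (((map_continuous φ).tendsto f).comp hp) (hsum.congr fun m => ?_)
  rw [tsum_aronBernerTaylor_polyFun, Function.comp_apply, character_polyAlg]

/-! ### The induced map of the bidual ball -/

section InducedMap

variable {k : Kind} {Φ : Automorphism X} (h : Preserves k Φ)

lemma projBall_spectrumMap_congr
    (hlim : ∀ ℓ : StrongDual ℂ X, IsUniformLimitFiniteType fun x => ℓ (Φ.toEquiv x))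
    {φ ψ : Spectrum X k} (hproj : projBall k φ = projBall k ψ) :
    projBall k (spectrumMap h φ) = projBall k (spectrumMap h ψ) :=
  bidualPt_injective <| ContinuousLinearMap.ext fun ℓ =>
    character_eq_of_proj_eq (f := compOp h (dualIncl k ℓ)) (hlim ℓ) (congrArg bidualPt hproj)

theorem exists_semiconj_projBall
    (hlim : ∀ ℓ : StrongDual ℂ X, IsUniformLimitFiniteType fun x => ℓ (Φ.toEquiv x)) :
    ∃ Ψ : C(BidualBall X, BidualBall X), Function.Semiconj (projBall k) (spectrumMap h) Ψ := by
  let g : C(Spectrum X k, BidualBall X) := (projBall k).comp ⟨_, continuous_spectrumMap h⟩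
  have hg : ∀ φ ψ, projBall k φ = projBall k ψ → g φ = g ψ :=
    fun _ _ => projBall_spectrumMap_congr h hlim
  exact ⟨(isQuotientMap_projBall k).lift g hg, fun φ =>
    (DFunLike.congr_fun ((isQuotientMap_projBall k).lift_comp g hg) φ).symm⟩

variable {h} {Ψ : C(BidualBall X, BidualBall X)}
  (hΨ : Function.Semiconj (projBall k) (spectrumMap h) Ψ)

include hΨ

theorem image_fiber_eq (h' : Preserves k Φ.symm)
    (hlim' : ∀ ℓ : StrongDual ℂ X, IsUniformLimitFiniteType fun x => ℓ (Φ.toEquiv.symm x))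
    (z : BidualBall X) :
    spectrumMap h '' fiber k (bidualPt z) = fiber k (bidualPt (Ψ z)) := by
  rw [Set.image_eq_preimage_of_inverse (leftInverse_spectrumMap h h')
    (rightInverse_spectrumMap h h')]
  ext φ
  rw [Set.mem_preimage, mem_fiber_bidualPt, mem_fiber_bidualPt]
  constructor
  · rintro rfl
    rw [← hΨ, rightInverse_spectrumMap h h' φ]
  · intro hφ
    obtain ⟨ψ, rfl⟩ := surjective_projBall k z
    rw [← hΨ] at hφ
    rw [projBall_spectrumMap_congr h' hlim' hφ, leftInverse_spectrumMap h h' ψ]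

lemma isWeakStarExtension_of_semiconj : IsWeakStarExtension Φ (Ψ.comp closedBallToBidual) :=
  fun x => congrArg bidualPt (hΨ (evalChar k x)).symm

lemma isCanonicalExtension_of_semiconj
    (hlim : ∀ ℓ : StrongDual ℂ X, IsUniformLimitFiniteType fun x => ℓ (Φ.toEquiv x)) :
    IsCanonicalExtension Φ Ψ := by
  intro z hz ℓ
  obtain ⟨φ, rfl⟩ := surjective_projBall k z
  rw [← hΨ]
  exact character_eq_canonicalExt (f := compOp h (dualIncl k ℓ)) (hlim ℓ) φ hz

end InducedMap

/-! ### Extensions of an automorphism -/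

lemma denseRange_ballIncl : DenseRange (ballIncl : Ball X → ClosedBall X) := by
  rw [ballIncl, denseRange_inclusion_iff, closure_ball (0 : X) one_ne_zero]

omit [NormedSpace ℂ X] in
lemma isUniformInducing_ballIncl : IsUniformInducing (ballIncl : Ball X → ClosedBall X) :=
  (isUniformEmbedding_set_inclusion ball_subset_closedBall).isUniformInducing

lemma exists_isContinuousExtension [CompleteSpace X] {Φ : Automorphism X}
    (hΦ : UniformContinuous Φ.toEquiv) :
    ∃ Φ' : C(ClosedBall X, ClosedBall X), IsContinuousExtension Φ Φ' := by
  have : CompleteSpace (ClosedBall X) := isClosed_closedBall.completeSpace_coe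
  have hunif : UniformContinuous fun x => ballIncl (Φ.toEquiv x) :=
    isUniformInducing_ballIncl.uniformContinuous.comp hΦ
  exact ⟨⟨_, (uniformContinuous_uniformly_extend isUniformInducing_ballIncl denseRange_ballIncl
      hunif).continuous⟩, fun x => congrArg Subtype.val (uniformly_extend_of_ind
    isUniformInducing_ballIncl denseRange_ballIncl hunif x)⟩

lemma IsContinuousExtension.eq {Φ : Automorphism X} {Φ₁ Φ₂ : C(ClosedBall X, ClosedBall X)}
    (h₁ : IsContinuousExtension Φ Φ₁) (h₂ : IsContinuousExtension Φ Φ₂) : Φ₁ = Φ₂ :=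
  DFunLike.coe_injective <| denseRange_ballIncl.equalizer Φ₁.continuous Φ₂.continuous <|
    funext fun x => Subtype.ext ((h₁ x).trans (h₂ x).symm)

lemma IsWeakStarExtension.eq {Φ : Automorphism X} {Φ₁ Φ₂ : C(ClosedBall X, BidualBall X)}
    (h₁ : IsWeakStarExtension Φ Φ₁) (h₂ : IsWeakStarExtension Φ Φ₂) : Φ₁ = Φ₂ :=
  DFunLike.coe_injective <| denseRange_ballIncl.equalizer Φ₁.continuous Φ₂.continuous <|
    funext fun x => bidualPt_injective ((h₁ x).trans (h₂ x).symm)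

lemma IsCanonicalExtension.eq {Φ : Automorphism X} {Ψ₁ Ψ₂ : C(BidualBall X, BidualBall X)}
    (h₁ : IsCanonicalExtension Φ Ψ₁) (h₂ : IsCanonicalExtension Φ Ψ₂) : Ψ₁ = Ψ₂ := by
  refine DFunLike.coe_injective <| denseRange_closedBallToBidual_ballIncl.equalizer Ψ₁.continuous
    Ψ₂.continuous <| funext fun x => bidualPt_injective <| ContinuousLinearMap.ext fun ℓ => ?_
  have hx : ‖bidualPt (closedBallToBidual (ballIncl x))‖ < 1 :=
    (norm_toBidual_le (x : X)).trans_lt (mem_ball_zero_iff.1 x.2)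
  exact (h₁ _ hx ℓ).trans (h₂ _ hx ℓ).symm

lemma IsContinuousExtension.isWeakStarExtension {Φ : Automorphism X}
    {Φ' : C(ClosedBall X, ClosedBall X)} (h : IsContinuousExtension Φ Φ') :
    IsWeakStarExtension Φ (closedBallToBidual.comp Φ') :=
  fun x => congrArg toBidual (h x)

end BallAlgebra

end

open BallAlgebra in
theorem mainTheorem11_general {X : Type*} [NormedAddCommGroup X] [NormedSpace ℂ X]
    (k : Kind) (Φ : Automorphism X)
    (hΦ : k = Kind.unif → UniformContinuous Φ.toEquiv ∧ UniformContinuous Φ.toEquiv.symm) :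
    ∃ (h : Preserves k Φ) (h' : Preserves k Φ.symm),
      (∀ φ ψ : Spectrum X k,
        gleasonDist (spectrumMap h φ) (spectrumMap h ψ) = gleasonDist φ ψ) ∧
      Function.Surjective (spectrumMap h) ∧
      Function.LeftInverse (spectrumMap h') (spectrumMap h) ∧
      Function.RightInverse (spectrumMap h') (spectrumMap h) ∧
      ((∀ ℓ : StrongDual ℂ X,
          IsUniformLimitFiniteType (fun x => ℓ (Φ.toEquiv x)) ∧
          IsUniformLimitFiniteType (fun x => ℓ (Φ.toEquiv.symm x))) →
        (∀ x : Ball X, spectrumMap h '' fiber k (toBidual (x : X)) =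
          fiber k (toBidual (Φ.toEquiv x : X))) ∧
        (∃! Φ' : C(ClosedBall X, BidualBall X), IsWeakStarExtension Φ Φ') ∧
        (∀ Φ' : C(ClosedBall X, BidualBall X), IsWeakStarExtension Φ Φ' →
          ∀ x : ClosedBall X,
            spectrumMap h '' fiber k (toBidual (x : X)) = fiber k (bidualPt (Φ' x))) ∧
        (CompleteSpace X → UniformContinuous Φ.toEquiv →
          ∃! Φ' : C(ClosedBall X, ClosedBall X), IsContinuousExtension Φ Φ') ∧
        (∀ Φ' : C(ClosedBall X, ClosedBall X), IsContinuousExtension Φ Φ' →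
          ∀ x : ClosedBall X,
            spectrumMap h '' fiber k (toBidual (x : X)) = fiber k (toBidual (Φ' x : X))) ∧
        (∃! Ψ : C(BidualBall X, BidualBall X), IsCanonicalExtension Φ Ψ) ∧
        ∀ Ψ : C(BidualBall X, BidualBall X), IsCanonicalExtension Φ Ψ →
          ∀ z : BidualBall X,
            spectrumMap h '' fiber k (bidualPt z) = fiber k (bidualPt (Ψ z))) := by
  have h : Preserves k Φ := preserves_of_uniformContinuous k Φ fun e => (hΦ e).1
  have h' : Preserves k Φ.symm := preserves_of_uniformContinuous k Φ.symm fun e => (hΦ e).2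
  refine ⟨h, h', gleasonDist_spectrumMap h h', (rightInverse_spectrumMap h h').surjective,
    leftInverse_spectrumMap h h', rightInverse_spectrumMap h h', fun hlim => ?_⟩
  obtain ⟨Ψ, hΨ⟩ := exists_semiconj_projBall h fun ℓ => (hlim ℓ).1
  have hfiber := image_fiber_eq hΨ h' fun ℓ => (hlim ℓ).2
  have hweak := isWeakStarExtension_of_semiconj hΨ
  have hcan := isCanonicalExtension_of_semiconj hΨ fun ℓ => (hlim ℓ).1
  have hweakFiber (Φ' : C(ClosedBall X, BidualBall X)) (hΦ' : IsWeakStarExtension Φ Φ')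
      (x : ClosedBall X) :
      spectrumMap h '' fiber k (toBidual (x : X)) = fiber k (bidualPt (Φ' x)) :=
    hΦ'.eq hweak ▸ hfiber (closedBallToBidual x)
  refine ⟨fun x => ?_, ⟨_, hweak, fun _ hΦ' => hΦ'.eq hweak⟩, hweakFiber, fun _ hunif => ?_,
    fun _ hΦ' => hweakFiber _ hΦ'.isWeakStarExtension, ⟨_, hcan, fun _ hΨ' => hΨ'.eq hcan⟩,
    fun _ hΨ' => hΨ'.eq hcan ▸ hfiber⟩
  · exact hweak x ▸ hweakFiber _ hweak (ballIncl x)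
  · obtain ⟨Φ', hΦ'⟩ := exists_isContinuousExtension hunif
    exact ⟨Φ', hΦ', fun _ hΦ'' => hΦ''.eq hΦ'⟩

open BallAlgebra in
theorem mainTheorem11 {X : Type*} [NormedAddCommGroup X] [NormedSpace ℂ X] [CompleteSpace X]
    (k : Kind) (Φ : Automorphism X)
    (hΦ : k = Kind.unif → UniformContinuous Φ.toEquiv ∧ UniformContinuous Φ.toEquiv.symm) :
    ∃ (h : Preserves k Φ) (h' : Preserves k Φ.symm),
      -- `Λ_Φ` is an onto isometry for the Gleason metric with inverse `Λ_{Φ⁻¹}`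
      (∀ φ ψ : Spectrum X k,
        gleasonDist (spectrumMap h φ) (spectrumMap h ψ) = gleasonDist φ ψ) ∧
      Function.Surjective (spectrumMap h) ∧
      Function.LeftInverse (spectrumMap h') (spectrumMap h) ∧
      Function.RightInverse (spectrumMap h') (spectrumMap h) ∧
      ((∀ ℓ : StrongDual ℂ X,
          IsUniformLimitFiniteType (fun x => ℓ (Φ.toEquiv x)) ∧
          IsUniformLimitFiniteType (fun x => ℓ (Φ.toEquiv.symm x))) →
        -- fibers over points of the open ball of `X`
        (∀ x : Ball X, spectrumMap h '' fiber k (toBidual (x : X)) =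
          fiber k (toBidual (Φ.toEquiv x : X))) ∧
        -- fibers over points of the closed ball of `X`, where `Φ` extends by continuity
        (∃! Φ' : C(ClosedBall X, BidualBall X), IsWeakStarExtension Φ Φ') ∧
        (∀ Φ' : C(ClosedBall X, BidualBall X), IsWeakStarExtension Φ Φ' →
          ∀ x : ClosedBall X,
            spectrumMap h '' fiber k (toBidual (x : X)) = fiber k (bidualPt (Φ' x))) ∧
        (UniformContinuous Φ.toEquiv →
          (∃! Φ' : C(ClosedBall X, ClosedBall X), IsContinuousExtension Φ Φ') ∧
          ∀ Φ' : C(ClosedBall X, ClosedBall X), IsContinuousExtension Φ Φ' →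
            ∀ x : ClosedBall X,
              spectrumMap h '' fiber k (toBidual (x : X)) = fiber k (toBidual (Φ' x : X))) ∧
        -- fibers over points of the closed ball of `X**`
        (SymmetricallyRegular X →
          (∃! Ψ : C(BidualBall X, BidualBall X), IsCanonicalExtension Φ Ψ) ∧
          ∀ Ψ : C(BidualBall X, BidualBall X), IsCanonicalExtension Φ Ψ →
            ∀ z : BidualBall X,
              spectrumMap h '' fiber k (bidualPt z) = fiber k (bidualPt (Ψ z)))) := by
  obtain ⟨h, h', hiso, hsurj, hleft, hright, hext⟩ := mainTheorem11_general k Φ hΦ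
  refine ⟨h, h', hiso, hsurj, hleft, hright, fun hlim => ?_⟩
  obtain ⟨hball, hweak, hweakFiber, hcont, hcontFiber, hcan⟩ := hext hlim
  exact ⟨hball, hweak, hweakFiber, fun hunif => ⟨hcont inferInstance hunif, hcontFiber⟩,
    fun _ => hcan⟩
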